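/- **Setting.** Let $\mathbf V$ be a finite set of variables with finite domains and $\mathcal G$ a causal diagram over $\mathbf V$ (an acyclic graph with directed and bidirected edges). A structural causal model (SCM) has mutually independent exogenous variables $\mathbf U$ and a mechanism $v\leftarrow f_V(pa_V,u_V)$ for each $V\in\mathbf V$. It conforms to $\mathcal G$ if the endogenous arguments of each $f_V$ are parents of $V$ in $\mathcal G$ and any two variables sharing an exogenous variable are joined by a bidirected edge. $P_{\mathbf x}(\mathbf y)$ is the probability of $\mathbf Y=\mathbf y$ after $\mathbf X$ is set to $\mathbf x$. There are a target domain $\pi^*$ and source domains $\Pi=\{\pi^i\}$, with discrepancies $\boldsymbol\Delta=\{\Delta^i\}$, $\Delta^i\subseteq\mathbf V$. A collection of SCMs, one per domain, *induces* the collective selection diagram $\mathcal G^{\boldsymbol\Delta}$ ($\mathcal G$ with a selection variable $S_V\to V$ added for each $V\in\bigcup_i\Delta^i$) if all conform to $\mathcal G$ and, for $V\notin\Delta^i$, the mechanism of $V$ and the laws of its exogenous arguments are the same in $\pi^i$ and $\pi^*$. $\mathbf S^i$ is the set of the $S_V$, $V\in\Delta^i$. $\mathbb Z=\{\mathbb Z^i\}$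 specifies the sets $\mathbf Z\in\mathbb Z^i$ on which experiments were made in $\pi^i$; the available distributions are $\mathcal P^\Pi_{\mathbb Z}=\{P^i_{\mathbf z}: \mathbf Z\in\mathbb Z^i,\ \mathbf z\in\Omega_{\mathbf Z}\}$, and are assumed strictly positive. $\mathtt{An}(\mathbf Y)_{\mathcal G}$ are the ancestors of $\mathbf Y$ ($\mathbf Y$ included), $\mathcal G_{\overline{\mathbf X}}$ is $\mathcal G$ without the edges having an arrowhead at $\mathbf X$, and $\mathsf{cc}_{\mathcal G}$ is the set of maximal c-components (classes of vertices connected by bidirected edges). **Algorithm.** Both procedures yield expressions in the available distributions. $\mathbf V$ denotes the vertices of the current graph. Values not determined by the query ($\mathbf z\setminus\mathbf V$, and the values of $\mathbf V'$ in step 3) may be fixed arbitrarily. $\mathrm{paTR}(\mathbf y,\mathbf x,\mathcal G,\boldsymbol\Delta,\mathsf{type})$, $\mathsf{type}\in\{\ell,u\}$: 1. For any $i$ and $\mathbf Z\in\mathbb Z^i$ with $\mathbf X=\mathbf Z\cap\mathbf V$ and $\mathbf S^i$ d-separated from $\mathbf Y$ in $\mathcal G^{\boldsymbol\Delta}\setminus\mathbf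 X$: yield $P^i_{\mathbf z\setminus\mathbf V,\ \mathbf x\cap\mathbf Z}(\mathbf y)$. In addition, the first applicable one of steps 2–5 is executed: 2. If $\mathbf V':=\mathbf V\setminus\mathtt{An}(\mathbf Y)_{\mathcal G}\ne\emptyset$: yield $\mathrm{paTR}(\mathbf y,\mathbf x\setminus\mathbf V',\mathcal G\setminus\mathbf V',\{\Delta^i\setminus\mathbf V'\},\mathsf{type})$. 3. If $\mathbf V':=(\mathbf V\setminus\mathbf X)\setminus\mathtt{An}(\mathbf Y)_{\mathcal G_{\overline{\mathbf X}}}\neq\emptyset$: yield $\mathrm{paTR}(\mathbf y,\mathbf x\cup\mathbf v',\mathcal G,\boldsymbol\Delta,\mathsf{type})$. 4. If $|\mathsf{cc}_{\mathcal G\setminus\mathbf X}|>1$: yield $\sum_{\mathbf v\setminus(\mathbf y\cup\mathbf x)}\prod_{\mathbf C\in\mathsf{cc}_{\mathcal G\setminus\mathbf X}}\mathrm{paTR}(\mathbf c,\mathbf v\setminus\mathbf c,\mathcal G,\boldsymbol\Delta,\mathsf{type})$ (for every choice of one expression per factor). 5. For every $i$ with $\Delta^i\cap(\mathbf V\setminus\mathbf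 X)=\emptyset$ and every $\mathbf Z\in\mathbb Z^i$ with $\mathbf Z\cap\mathbf V\subseteq\mathbf X$: yield $\mathrm{paID}(\mathbf y,\mathbf x\setminus\mathbf Z,P^i_{\mathbf z\setminus\mathbf V,\ \mathbf x\cap\mathbf Z},\mathcal G\setminus(\mathbf Z\cap\mathbf X),\mathsf{type})$. $\mathrm{paID}(\mathbf y,\mathbf x,P,\mathcal G,\mathsf{type})$, with $\{\mathbf C\}=\mathsf{cc}_{\mathcal G\setminus\mathbf X}$ and a topological order $\pi$ of $\mathcal G$ in which $\mathbf v_\pi^{(i-1)}$ are the predecessors of $V_i$; the first applicable case is executed: 1. $\mathbf X=\emptyset$: yield $\sum_{\mathbf v\setminus\mathbf y}P(\mathbf v)$. 2. $\mathbf V\ne\mathbf A:=\mathtt{An}(\mathbf Y)_{\mathcal G}$: yield $\mathrm{paID}(\mathbf y,\mathbf x\cap\mathbf A,\sum_{\mathbf v\setminus\mathbf a}P(\mathbf v),\mathcal G[\mathbf A],\mathsf{type})$. 3. $\mathsf{cc}_{\mathcal G}=\{\mathbf V\}$: yield $\sum_{\mathbf v\setminus(\mathbf y\cup\mathbf x)}P(\mathbf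 v)$ if $\mathsf{type}=\ell$, and $\sum_{\mathbf v\setminus(\mathbf y\cup\mathbf x)}\{P(\mathbf v)+1-\sum_{\mathbf v\setminus\mathbf x}P(\mathbf v)\}$ if $\mathsf{type}=u$. 4. $\mathbf C\in\mathsf{cc}_{\mathcal G}$: yield $\sum_{\mathbf c\setminus\mathbf y}\prod_{V_i\in\mathbf C}P(v_i\mid\mathbf v_\pi^{(i-1)})$. 5. $\mathbf C\subsetneq\mathbf C'\in\mathsf{cc}_{\mathcal G}$: yield $\mathrm{paID}(\mathbf y,\mathbf x\cap\mathbf C',\prod_{V_i\in\mathbf C'}P(v_i\mid\mathbf v_\pi^{(i-1)}),\mathcal G[\mathbf C'],\mathsf{type})$. **Proposition.** Let $\mathbf X,\mathbf Y\subseteq\mathbf V$ be disjoint. (a) *Soundness.* Every expression yielded by $\mathrm{paTR}(\mathbf y,\mathbf x,\mathcal G,\boldsymbol\Delta,\ell)$ (resp. by $\mathrm{paTR}(\mathbf y,\mathbf x,\mathcal G,\boldsymbol\Delta,u)$), evaluated at the available distributions of any collection of SCMs that induces $\mathcal G^{\boldsymbol\Delta}$, is a lower (resp. upper) bound for $P^*_{\mathbf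 x}(\mathbf y)$, for all values $\mathbf x,\mathbf y$. (b) *Partial transportability.* If $\ell$ is any expression yielded with $\mathsf{type}=\ell$ and $u=\min\{1,u'\}$ with $u'$ any expression yielded with $\mathsf{type}=u$, then $[\ell,u]$ is a partially transportable bound for $P^*_{\mathbf x}(\mathbf y)$ with respect to $\langle\mathcal G^{\boldsymbol\Delta},\mathbb Z\rangle$: it is computed from $\mathcal P^\Pi_{\mathbb Z}$ alone, and for every collection of SCMs that induces $\mathcal G^{\boldsymbol\Delta}$, $[\ell,u]\subsetneq[0,1]$ and $P^*_{\mathbf x}(\mathbf y)\in[\ell,u]$. -/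

import Mathlib

universe uV uΩ uι uκ uU

/-! ## Mixed graphs -/

/-- A graph with directed and bidirected edges on a finite set of vertices. -/
structure MixedGraph (N : Type*) where
  verts : Finset N
  dir : N → N → Prop
  bi : N → N → Prop

namespace MixedGraph

section Basic

variable {N : Type*} [DecidableEq N]

/-- The induced subgraph `G[W]`. -/
def induce (G : MixedGraph N) (W : Finset N) : MixedGraph N where
  verts := G.verts ∩ W
  dir a b := G.dir a b ∧ a ∈ W ∧ b ∈ W
  bi a b := G.bi a b ∧ a ∈ W ∧ b ∈ W

/-- Deletion of vertices, `G \ X`. -/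
def del (G : MixedGraph N) (X : Finset N) : MixedGraph N :=
  G.induce (G.verts \ X)

/-- `G` with every edge that has an arrowhead at a vertex of `X` removed. -/
def cutIncoming (G : MixedGraph N) (X : Finset N) : MixedGraph N where
  verts := G.verts
  dir a b := G.dir a b ∧ b ∉ X
  bi a b := G.bi a b ∧ a ∉ X ∧ b ∉ X

open Classical in
/-- The ancestors of `Y` in `G` (the vertices of `Y` included). -/
noncomputable def An (G : MixedGraph N) (Y : Finset N) : Finset N :=
  G.verts.filter fun a => ∃ y ∈ Y, Relation.ReflTransGen G.dir a y

open Classical in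
/-- The vertex sets of the maximal c-components of `G`, that is, of the classes of vertices
connected by bidirected edges. -/
noncomputable def cc (G : MixedGraph N) : Finset (Finset N) :=
  G.verts.image fun a => G.verts.filter fun b => Relation.ReflTransGen G.bi a b

end Basic

/-! ## d-separation -/

/-- The way in which an edge is traversed along a path: `a → b`, `a ← b` or `a ↔ b`. -/
inductive Mark
  | fwd
  | bwd
  | bid

variable {N : Type*}

/-- `G` has an edge that leads from `a` to `b` in the given way. -/
def Step (G : MixedGraph N) (a : N) : Mark → N → Prop
  | .fwd, b => G.dir a b
  | .bwd, b => G.dir b a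
  | .bid, b => G.bi a b

/-- An inner vertex of a path, entered by `m` and left by `n`, is a collider if both edges have
an arrowhead at it. -/
def IsCollider (m n : Mark) : Prop := m ≠ Mark.bwd ∧ n ≠ Mark.fwd

/-- The inner vertex `b`, entered by `m` and left by `n`, does not block the path relative
to `Z`: a collider is an ancestor of a member of `Z`, a non-collider is not in `Z`. -/
def OpenAt (G : MixedGraph N) (Z : Finset N) (m : Mark) (b : N) (n : Mark) : Prop :=
  (IsCollider m n → ∃ z ∈ Z, Relation.ReflTransGen G.dir b z) ∧ (¬ IsCollider m n → b ∉ Z)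

/-- `OpenPath G Z a l m b`: there is a path from `a` to `b` in `G`, d-connecting relative to `Z`,
whose vertices, all distinct, are listed in `l` from last to first, and whose last edge is
traversed as `m`. -/
inductive OpenPath (G : MixedGraph N) (Z : Finset N) (a : N) : List N → Mark → N → Prop
  | single {m : Mark} {b : N} : G.Step a m b → a ≠ b → OpenPath G Z a [b, a] m b
  | snoc {l : List N} {m n : Mark} {b c : N} : OpenPath G Z a l m b → G.Step b n c → c ∉ l →
      G.OpenAt Z m b n → OpenPath G Z a (c :: l) n c

/-- The disjoint sets `A` and `B` are d-separated by `Z` in `G`. -/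
def DSep (G : MixedGraph N) (A B Z : Finset N) : Prop :=
  ∀ a ∈ A, ∀ b ∈ B, ∀ l m, ¬ G.OpenPath Z a l m b

/-! ## Selection diagrams -/

variable {V ι : Type*} [Fintype V] [DecidableEq V]

open Classical in
/-- The collective selection diagram of `G` with discrepancies `Δ`: the vertex `Sum.inl v` is
the variable `v`, and the vertex `Sum.inr v`, which exists for `v` in some `Δ i`, is the
selection variable that points to `v`. -/
noncomputable def selectionDiagram (G : MixedGraph V) (Δ : ι → Finset V) :
    MixedGraph (V ⊕ V) where
  verts := G.verts.disjSum (Finset.univ.filter fun v => ∃ i, v ∈ Δ i)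
  dir
    | .inl a, .inl b => G.dir a b
    | .inr a, .inl b => a = b ∧ b ∈ G.verts ∧ ∃ i, b ∈ Δ i
    | _, .inr _ => False
  bi
    | .inl a, .inl b => G.bi a b
    | _, _ => False

/-- The set of variables `X`, as vertices of a selection diagram. -/
def obs (X : Finset V) : Finset (V ⊕ V) := X.map Function.Embedding.inl

/-- The selection variables that point to the variables in `D`. -/
def sel (D : Finset V) : Finset (V ⊕ V) := D.map Function.Embedding.inr

end MixedGraph

/-- A causal diagram over the variables `V`: an acyclic directed mixed graph. -/
structure CausalDiagram (V : Type*) [Fintype V] extends MixedGraph V where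
  verts_eq : verts = Finset.univ
  bi_symm : ∀ a b, bi a b → bi b a
  bi_irrefl : ∀ a, ¬ bi a a
  acyclic : ∀ a, ¬ Relation.TransGen dir a a

/-! ## Structural causal models -/

/-- A joint assignment of values to all variables. The values `x` of a set `X` of variables are
given throughout as the restriction to `X` of such an assignment. -/
abbrev Assign {V : Type*} (Ω : V → Type*) := ∀ v, Ω v

/-- A structural causal model with endogenous variables `V` (with values in `Ω`) and mutually
independent exogenous variables `κ` (with values in `U`). `pa v` and `exo v` are the endogenous
and the exogenous variables that are arguments of the mechanism `f v`, and `μ k` is the law of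
the exogenous variable `k`. -/
structure SCM {V : Type*} (Ω : V → Type*) {κ : Type*} (U : κ → Type*)
    [∀ k, MeasurableSpace (U k)] where
  pa : V → Set V
  exo : V → Set κ
  f : ∀ v, Assign Ω → (∀ k, U k) → Ω v
  f_local : ∀ v s t u u₁, (∀ w ∈ pa v, s w = t w) → (∀ k ∈ exo v, u k = u₁ k) →
    f v s u = f v t u₁
  f_meas : ∀ v s a, MeasurableSet {u | f v s u = a}
  μ : ∀ k, MeasureTheory.Measure (U k)
  prob : ∀ k, MeasureTheory.IsProbabilityMeasure (μ k)

namespace SCM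

variable {V : Type*} [Fintype V] {Ω : V → Type*} {κ : Type*} {U : κ → Type*}
  [∀ k, MeasurableSpace (U k)]

/-- `s` solves the equations of the submodel in which `X` is set to its values in `x`, for the
unit `u`. -/
def IsSolution (M : SCM Ω U) (X : Finset V) (x : Assign Ω) (u : ∀ k, U k) (s : Assign Ω) : Prop :=
  (∀ v ∈ X, s v = x v) ∧ ∀ v ∉ X, s v = M.f v s u

/-- The interventional probability `P_x(y)`, where `x` and `y` are the restrictions of `v` to
`X` and `Y`: the probability that the solution of the submodel in which `X` is set to `x`
(unique if the model is acyclic) has the value `y` on `Y`. -/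
noncomputable def doProb [Fintype κ] (M : SCM Ω U) (X Y : Finset V) (v : Assign Ω) : ℝ :=
  (MeasureTheory.Measure.pi M.μ).real {u | ∃ s, M.IsSolution X v u s ∧ ∀ w ∈ Y, s w = v w}

/-- The model conforms to the causal diagram `G`: arguments of a mechanism are parents in `G`, and
variables that share an exogenous variable are joined by a bidirected edge. -/
def CompatibleWith (M : SCM Ω U) (G : CausalDiagram V) : Prop :=
  (∀ v, ∀ w ∈ M.pa v, G.dir w v) ∧
    ∀ v w, v ≠ w → (M.exo v ∩ M.exo w).Nonempty → G.bi v w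

end SCM

/-- A collection of models with common variables: one for the target domain and one for each
source domain `i : ι`. -/
structure ModelCollection {V : Type uV} (Ω : V → Type uΩ)
    (ι : Type uι) where
  κ : Type uκ
  [fintype_κ : Fintype κ]
  U : κ → Type uU
  [measurable_U : ∀ k, MeasurableSpace (U k)]
  target : SCM Ω U
  source : ι → SCM Ω U

attribute [instance] ModelCollection.fintype_κ ModelCollection.measurable_U

/-- The available distributions, that is, those of the experiments `𝒵`: for a source domain `i`
and an experiment `Z ∈ 𝒵 i`, the value at `v` stands for `P^i_z(v \ z)`, where `z` is the
restriction of `v` to `Z`. -/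
abbrev ExpData {V ι : Type*} (Ω : V → Type*) (𝒵 : ι → Finset (Finset V)) :=
  ∀ i : ι, {Z : Finset V // Z ∈ 𝒵 i} → Assign Ω → ℝ

namespace ModelCollection

variable {V ι : Type*} [Fintype V] [DecidableEq V] {Ω : V → Type*}

/-- The models induce the collective selection diagram given by `G` and `Δ`: all of them conform
to `G`, and the mechanism of `v` and the laws of its exogenous arguments differ between the target
and the source `i` only if `v ∈ Δ i`. -/
def Induces (𝓜 : ModelCollection Ω ι) (G : CausalDiagram V) (Δ : ι → Finset V) : Prop :=
  𝓜.target.CompatibleWith G ∧ (∀ i, (𝓜.source i).CompatibleWith G) ∧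
    ∀ i, ∀ v ∉ Δ i, (𝓜.source i).f v = 𝓜.target.f v ∧
      (𝓜.source i).exo v = 𝓜.target.exo v ∧
      ∀ k ∈ 𝓜.target.exo v, (𝓜.source i).μ k = 𝓜.target.μ k

/-- The distributions of the experiments `𝒵` in the given models. -/
noncomputable def data (𝓜 : ModelCollection Ω ι) (𝒵 : ι → Finset (Finset V)) : ExpData Ω 𝒵 :=
  fun i Z v => (𝓜.source i).doProb Z.1 Z.1ᶜ v

/-- All available distributions are strictly positive. -/
def Positive (𝓜 : ModelCollection Ω ι) (𝒵 : ι → Finset (Finset V)) : Prop :=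
  ∀ i Z v, 0 < 𝓜.data 𝒵 i Z v

end ModelCollection

/-! ## Expressions -/

section Expressions

variable {V ι : Type*} [Fintype V] [DecidableEq V] {Ω : V → Type*} [∀ v, Fintype (Ω v)]
  {𝒵 : ι → Finset (Finset V)}

/-- The assignment that equals `v` on `W` and `w` off `W`. -/
def mergeOn (W : Finset V) (v w : Assign Ω) : Assign Ω := fun a => if a ∈ W then v a else w a

/-- An expression in the available distributions; its free variables take their values from the
assignment. -/
abbrev Expression {V ι : Type*} (Ω : V → Type*) (𝒵 : ι → Finset (Finset V)) :=
  ExpData Ω 𝒵 → Assign Ω → ℝ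

namespace Expression

open Classical in
/-- `∑_t e`, the sum over all values `t` of the variables in `T`. -/
noncomputable def sum (T : Finset V) (e : Expression Ω 𝒵) : Expression Ω 𝒵 :=
  fun D v => ∑ w ∈ Finset.univ.filter (fun w : Assign Ω => ∀ a ∉ T, w a = v a), e D w

/-- `P(v_i | v_π^{(i-1)})` for a distribution `P` over the variables in `W` ordered by `π`. -/
noncomputable def cond (W : Finset V) (π : V → ℕ) (P : Expression Ω 𝒵) (i : V) :
    Expression Ω 𝒵 :=
  fun D v => sum (W.filter fun a => π i < π a) P D v / sum (W.filter fun a => π i ≤ π a) P D v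

/-- `∏_{V_i ∈ C} P(v_i | v_π^{(i-1)})` for a distribution `P` over the variables in `W`. -/
noncomputable def condProd (W : Finset V) (π : V → ℕ) (P : Expression Ω 𝒵) (C : Finset V) :
    Expression Ω 𝒵 :=
  fun D v => ∏ i ∈ C, cond W π P i D v

/-- The distribution `P^i_{z \ W, x ∩ Z}` over the variables in `W \ Z`, where the values of `Z`
outside `W` are those in `z`. -/
noncomputable def experiment (i : ι) (Z : {Z : Finset V // Z ∈ 𝒵 i}) (W : Finset V)
    (z : Assign Ω) : Expression Ω 𝒵 :=
  fun D v => sum (W ∪ Z.1)ᶜ (fun D => D i Z) D (mergeOn W v z)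

end Expression

end Expressions

/-! ## The algorithm -/

/-- The type of a bound: lower or upper. -/
inductive BoundType
  | lower
  | upper

/-- `π` is a topological order of the vertices of `G`. -/
def IsTopologicalOrder {V : Type*} (G : MixedGraph V) (π : V → ℕ) : Prop :=
  Set.InjOn π G.verts ∧ ∀ a b, G.dir a b → π a < π b

section Algorithm

variable {V ι : Type*} [Fintype V] [DecidableEq V] {Ω : V → Type*} [∀ v, Fintype (Ω v)]
  {𝒵 : ι → Finset (Finset V)}

/-- The natural bound of the given type, for `P` over the variables in `W`. -/
noncomputable def naturalBound (Y X W : Finset V) (P : Expression Ω 𝒵) :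
    BoundType → Expression Ω 𝒵
  | .lower => Expression.sum (W \ (Y ∪ X)) P
  | .upper => Expression.sum (W \ (Y ∪ X))
      fun D v => P D v + 1 - Expression.sum (W \ X) P D v

/-- `PaID t Y X P G e`: the procedure `paID(y, x, P, G, t)` yields the expression `e`. The
constructors are the branches of the procedure, tried in this order. -/
inductive PaID (t : BoundType) :
    Finset V → Finset V → Expression Ω 𝒵 → MixedGraph V → Expression Ω 𝒵 → Prop
  | noIntervention {Y X : Finset V} {P : Expression Ω 𝒵} {G : MixedGraph V} :
      X = ∅ →
      PaID t Y X P G (Expression.sum (G.verts \ Y) P)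
  | ancestors {Y X : Finset V} {P : Expression Ω 𝒵} {G : MixedGraph V} {e : Expression Ω 𝒵} :
      X ≠ ∅ → G.verts ≠ G.An Y →
      PaID t Y (X ∩ G.An Y) (Expression.sum (G.verts \ G.An Y) P) (G.induce (G.An Y)) e →
      PaID t Y X P G e
  | natural {Y X : Finset V} {P : Expression Ω 𝒵} {G : MixedGraph V} :
      X ≠ ∅ → G.verts = G.An Y → G.cc = {G.verts} →
      PaID t Y X P G (naturalBound Y X G.verts P t)
  | component {Y X : Finset V} {P : Expression Ω 𝒵} {G : MixedGraph V} (C : Finset V)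
      (π : V → ℕ) :
      X ≠ ∅ → G.verts = G.An Y → G.cc ≠ {G.verts} → (G.del X).cc = {C} →
      IsTopologicalOrder G π → C ∈ G.cc →
      PaID t Y X P G (Expression.sum (C \ Y) (Expression.condProd G.verts π P C))
  | subcomponent {Y X : Finset V} {P : Expression Ω 𝒵} {G : MixedGraph V} {e : Expression Ω 𝒵}
      (C K : Finset V) (π : V → ℕ) :
      X ≠ ∅ → G.verts = G.An Y → G.cc ≠ {G.verts} → (G.del X).cc = {C} →
      IsTopologicalOrder G π → C ⊂ K → K ∈ G.cc →
      PaID t Y (X ∩ K) (Expression.condProd G.verts π P K) (G.induce K) e →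
      PaID t Y X P G e

/-- `PaTR t Y X G Δ e`: the algorithm `paTR(y, x, G, Δ, t)` yields the expression `e`. Each
constructor is a line of the algorithm. Lines that need values of variables on which the query
puts no condition may use any fixed values (`z` and `w` below). -/
inductive PaTR (t : BoundType) :
    Finset V → Finset V → MixedGraph V → (ι → Finset V) → Expression Ω 𝒵 → Prop
  | direct {Y X : Finset V} {G : MixedGraph V} {Δ : ι → Finset V} (i : ι)
      (Z : {Z : Finset V // Z ∈ 𝒵 i}) (z : Assign Ω) :
      X = Z.1 ∩ G.verts →
      ((G.selectionDiagram Δ).del (MixedGraph.obs X)).DSep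
        (MixedGraph.sel (Δ i)) (MixedGraph.obs Y) ∅ →
      PaTR t Y X G Δ
        (Expression.sum (G.verts \ (Y ∪ X)) (Expression.experiment i Z G.verts z))
  | nonAncestors {Y X : Finset V} {G : MixedGraph V} {Δ : ι → Finset V} {e : Expression Ω 𝒵}
      (R : Finset V) :
      R = G.verts \ G.An Y → R ≠ ∅ →
      PaTR t Y (X \ R) (G.del R) (fun i => Δ i \ R) e →
      PaTR t Y X G Δ e
  | extend {Y X : Finset V} {G : MixedGraph V} {Δ : ι → Finset V} {e : Expression Ω 𝒵}
      (R : Finset V) (w : Assign Ω) :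
      G.verts \ G.An Y = ∅ →
      R = (G.verts \ X) \ (G.cutIncoming X).An Y → R ≠ ∅ →
      PaTR t Y (X ∪ R) G Δ e →
      PaTR t Y X G Δ (fun D v => e D (mergeOn R w v))
  | factorize {Y X : Finset V} {G : MixedGraph V} {Δ : ι → Finset V}
      (E : Finset V → Expression Ω 𝒵) :
      G.verts \ G.An Y = ∅ → (G.verts \ X) \ (G.cutIncoming X).An Y = ∅ →
      1 < (G.del X).cc.card →
      (∀ C ∈ (G.del X).cc, PaTR t C (G.verts \ C) G Δ (E C)) →
      PaTR t Y X G Δ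
        (Expression.sum (G.verts \ (Y ∪ X)) fun D v => ∏ C ∈ (G.del X).cc, E C D v)
  | identify {Y X : Finset V} {G : MixedGraph V} {Δ : ι → Finset V} {e : Expression Ω 𝒵} (i : ι)
      (Z : {Z : Finset V // Z ∈ 𝒵 i}) (z : Assign Ω) :
      G.verts \ G.An Y = ∅ → (G.verts \ X) \ (G.cutIncoming X).An Y = ∅ →
      ¬ 1 < (G.del X).cc.card →
      Δ i ∩ (G.verts \ X) = ∅ → Z.1 ∩ G.verts ⊆ X →
      PaID t Y (X \ Z.1) (Expression.experiment i Z G.verts z) (G.del (Z.1 ∩ X)) e →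
      PaTR t Y X G Δ e

end Algorithm

/-! ## Partial transportability -/

/-- `[ℓ, u]`, computed from the available distributions alone, is a partially transportable bound
for `P*_x(y)` with respect to the selection diagram of `G` and `Δ` and the experiments `𝒵`: for
all collections of models that induce the selection diagram (with positive available
distributions) it is strictly contained in `[0, 1]` and contains `P*_x(y)`. -/
def IsPartiallyTransportableBound {V : Type uV} {ι : Type uι} [Fintype V]
    [DecidableEq V] {Ω : V → Type uΩ} (G : CausalDiagram V) (Δ : ι → Finset V)
    (𝒵 : ι → Finset (Finset V)) (X Y : Finset V) (v : Assign Ω) (ℓ u : ExpData Ω 𝒵 → ℝ) : Prop :=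
  ∀ 𝓜 : ModelCollection.{uV, uΩ, uι, uκ, uU} Ω ι, 𝓜.Induces G Δ → 𝓜.Positive 𝒵 →
    Set.Icc (ℓ (𝓜.data 𝒵)) (u (𝓜.data 𝒵)) ⊂ Set.Icc 0 1 ∧
      𝓜.target.doProb X Y v ∈ Set.Icc (ℓ (𝓜.data 𝒵)) (u (𝓜.data 𝒵))

/-!
Write `Q[W]` (the *c-factor* of `W`) for the probability that the variables in `W` take their
values when all others are set to theirs, so that `P_x(y)` is a sum of values of `Q[V \ X]`.
Independence of the exogenous variables makes `Q` multiplicative over c-components, and acyclicity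
makes summing `Q[W]` over `W \ A` give `Q[A]` whenever `A` contains the parents in `W` of its
members. Dividing consecutive `Q`s along a topological order therefore recovers `Q[C]` for a
c-component `C` of `W` from `Q[W]`, and `Q[W]` depends only on the mechanisms and the exogenous laws
of `W`, which transports it between domains that agree on `W`; d-separation of `Y` from the
selection variables puts their targets outside of the ancestors of `Y`, on which the query depends.
Every step of the two procedures is one of these identities except the natural bounds, which come
from `Q[W] ≤ Q[W \ X] ≤ Q[W] + 1 - ∑_{w \ x} Q[W]`.
-/

/-! ## Marginals -/

section Marginal

variable {V ι : Type*} [Fintype V] [DecidableEq V] {Ω : V → Type*} [∀ v, Fintype (Ω v)]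
  {𝒵 : ι → Finset (Finset V)} {T S : Finset V} {g h : Assign Ω → ℝ} {v w : Assign Ω}

open Classical in
/-- The sum of `g` over all values of the variables in `T`: the counterpart of `Expression.sum` for
a function of the assignment alone. -/
noncomputable def marginal (T : Finset V) (g : Assign Ω → ℝ) (v : Assign Ω) : ℝ :=
  ∑ w ∈ Finset.univ.filter (fun w : Assign Ω => ∀ a ∉ T, w a = v a), g w

theorem Expression.sum_eq_marginal (T : Finset V) (e : Expression Ω 𝒵) (D : ExpData Ω 𝒵) :
    Expression.sum T e D = marginal T (e D) :=
  rfl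

theorem marginal_congr_assign (g : Assign Ω → ℝ) (h : ∀ a ∉ T, v a = w a) :
    marginal T g v = marginal T g w := by
  classical
  exact Finset.sum_congr (Finset.filter_congr fun s _ => forall₂_congr fun a ha => by rw [h a ha])
    fun _ _ => rfl

theorem marginal_mono (hgh : ∀ v, g v ≤ h v) (v : Assign Ω) : marginal T g v ≤ marginal T h v :=
  Finset.sum_le_sum fun w _ => hgh w

theorem marginal_pos (hg : ∀ v, 0 < g v) (v : Assign Ω) : 0 < marginal T g v :=
  Finset.sum_pos (fun w _ => hg w) ⟨v, by simp⟩

theorem marginal_empty (g : Assign Ω → ℝ) : marginal ∅ g = g := by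
  funext v
  exact (Finset.sum_congr (by ext w; simp [funext_iff]) fun _ _ => rfl).trans
    (Finset.sum_singleton g v)

theorem marginal_marginal (hTS : Disjoint T S) (g : Assign Ω → ℝ) (v : Assign Ω) :
    marginal T (marginal S g) v = marginal (T ∪ S) g v := by
  classical
  have hmaps : ∀ w ∈ Finset.univ.filter (fun w : Assign Ω => ∀ a ∉ T ∪ S, w a = v a),
      mergeOn S v w ∈ Finset.univ.filter (fun w : Assign Ω => ∀ a ∉ T, w a = v a) := by
    simp only [Finset.mem_filter_univ, mergeOn]
    grind
  simp only [marginal]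
  rw [← Finset.sum_fiberwise_of_maps_to hmaps]
  refine Finset.sum_congr rfl fun t ht => Finset.sum_congr ?_ fun _ _ => rfl
  rw [Finset.mem_filter_univ] at ht
  ext w
  simp only [Finset.mem_filter, Finset.mem_univ, true_and, funext_iff, mergeOn]
  grind [Finset.disjoint_left]

end Marginal

/-! ## Events that depend on some coordinates of a product space -/

section ProductSpace

open MeasureTheory ProbabilityTheory

variable {κ : Type*} {U : κ → Type*} [∀ k, MeasurableSpace (U k)] {E F : Set (∀ k, U k)}

theorem exists_eq_cylinder_of_dependsOn [∀ k, Nonempty (U k)] {S : Finset κ}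
    (hE : MeasurableSet E) (hES : DependsOn (· ∈ E) (S : Set κ)) :
    ∃ E' : Set (∀ k : S, U k), MeasurableSet E' ∧ E = cylinder S E' := by
  classical
  let fill : (∀ k : S, U k) → ∀ k, U k := Function.updateFinset (fun _ => Classical.arbitrary _) S
  refine ⟨fill ⁻¹' E, measurable_updateFinset hE, Set.ext fun u => Eq.to_iff ?_⟩
  exact hES fun k hk => by simp [fill, Function.updateFinset, Finset.mem_coe.1 hk]

variable [Fintype κ] (μ ν : ∀ k, Measure (U k)) [∀ k, IsProbabilityMeasure (μ k)]
  [∀ k, IsProbabilityMeasure (ν k)] {S T : Set κ}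

theorem measureReal_pi_inter_of_dependsOn (hST : Disjoint S T) (hE : MeasurableSet E)
    (hF : MeasurableSet F) (hES : DependsOn (· ∈ E) S) (hFT : DependsOn (· ∈ F) T) :
    (Measure.pi μ).real (E ∩ F) = (Measure.pi μ).real E * (Measure.pi μ).real F := by
  have (k : κ) : Nonempty (U k) := nonempty_of_isProbabilityMeasure (μ k)
  lift S to Finset κ using S.toFinite
  lift T to Finset κ using T.toFinite
  obtain ⟨E', hE', rfl⟩ := exists_eq_cylinder_of_dependsOn hE hES
  obtain ⟨F', hF', rfl⟩ := exists_eq_cylinder_of_dependsOn hF hFT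
  have hindep : iIndepFun (fun k (u : ∀ k, U k) => u k) (Measure.pi μ) :=
    iIndepFun_pi (X := fun _ => id) fun _ => aemeasurable_id
  rw [measureReal_def, measureReal_def, measureReal_def, ← ENNReal.toReal_mul]
  exact congrArg ENNReal.toReal <|
    (hindep.indepFun_finset S T (Finset.disjoint_coe.1 hST)
      fun k => measurable_pi_apply k).measure_inter_preimage_eq_mul E' F' hE' hF'

theorem measureReal_pi_congr_of_dependsOn (hμν : ∀ k ∈ S, μ k = ν k) (hE : MeasurableSet E)
    (hES : DependsOn (· ∈ E) S) : (Measure.pi μ).real E = (Measure.pi ν).real E := by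
  have (k : κ) : Nonempty (U k) := nonempty_of_isProbabilityMeasure (μ k)
  lift S to Finset κ using S.toFinite
  obtain ⟨E', hE', rfl⟩ := exists_eq_cylinder_of_dependsOn hE hES
  have hμν' : (fun k : S => μ k) = fun k : S => ν k := funext fun k => hμν k k.2
  simp only [measureReal_def, ← Measure.infinitePi_eq_pi, Measure.infinitePi_cylinder _ hE']
  rw [hμν']

end ProductSpace

/-! ## Subgraphs, ancestors and c-components -/

namespace MixedGraph

section Subgraph

variable {N : Type*}

/-- `H` is the subgraph of `G` induced by the vertices of `H`. -/
structure IsInducedSubgraph (H G : MixedGraph N) : Prop where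
  verts_subset : H.verts ⊆ G.verts
  dir_iff : ∀ {a b}, H.dir a b ↔ G.dir a b ∧ a ∈ H.verts ∧ b ∈ H.verts
  bi_iff : ∀ {a b}, H.bi a b ↔ G.bi a b ∧ a ∈ H.verts ∧ b ∈ H.verts

/-- `A` is an ancestral subset of `W`: it contains the parents, in `W`, of its members. The edges
are those of the ambient graph `G`, also when `W` is the vertex set of a subgraph. -/
structure IsAncestralIn (G : MixedGraph N) (A W : Finset N) : Prop where
  subset : A ⊆ W
  mem_of_dir : ∀ {a b}, b ∈ A → a ∈ W → G.dir a b → a ∈ A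

variable {H G : MixedGraph N} {A B C W Y : Finset N} {a b : N}

theorem IsInducedSubgraph.not_transGen_dir_self (hH : H.IsInducedSubgraph G)
    (hG : ∀ a, ¬ Relation.TransGen G.dir a a) (a : N) : ¬ Relation.TransGen H.dir a a :=
  fun h => hG a (Relation.TransGen.mono (fun _ _ hab => (hH.dir_iff.1 hab).1) a a h)

theorem IsInducedSubgraph.symm_bi (hH : H.IsInducedSubgraph G) (hG : ∀ a b, G.bi a b → G.bi b a) :
    Std.Symm H.bi where
  symm a b hab := by
    obtain ⟨hbi, ha, hb⟩ := hH.bi_iff.1 hab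
    exact hH.bi_iff.2 ⟨hG a b hbi, hb, ha⟩

theorem IsAncestralIn.trans (hAB : G.IsAncestralIn A B) (hBW : G.IsAncestralIn B W) :
    G.IsAncestralIn A W where
  subset := hAB.subset.trans hBW.subset
  mem_of_dir hb ha hab := hAB.mem_of_dir hb (hBW.mem_of_dir (hAB.subset hb) ha hab) hab

theorem An_subset_verts (G : MixedGraph N) (Y : Finset N) : G.An Y ⊆ G.verts := by
  classical exact Finset.filter_subset _ _

theorem mem_An_of_mem (ha : a ∈ G.verts) (haY : a ∈ Y) : a ∈ G.An Y := by
  classical exact Finset.mem_filter.2 ⟨ha, a, haY, .refl⟩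

theorem mem_An_of_dir (ha : a ∈ G.verts) (hab : G.dir a b) (hb : b ∈ G.An Y) : a ∈ G.An Y := by
  classical
  obtain ⟨-, y, hy, hby⟩ := Finset.mem_filter.1 hb
  exact Finset.mem_filter.2 ⟨ha, y, hy, .head hab hby⟩

theorem IsInducedSubgraph.isAncestralIn_An (hH : H.IsInducedSubgraph G) (Y : Finset N) :
    G.IsAncestralIn (H.An Y) H.verts where
  subset := H.An_subset_verts Y
  mem_of_dir hb ha hab := mem_An_of_dir ha (hH.dir_iff.2 ⟨hab, ha, H.An_subset_verts Y hb⟩) hb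

theorem IsInducedSubgraph.isAncestralIn_filter_lt (hH : H.IsInducedSubgraph G) {π : N → ℕ}
    (hπ : IsTopologicalOrder H π) (n : ℕ) :
    G.IsAncestralIn (H.verts.filter fun a => π a < n) H.verts where
  subset := Finset.filter_subset _ _
  mem_of_dir hb ha hab := by
    rw [Finset.mem_filter] at hb ⊢
    exact ⟨ha, (hπ.2 _ _ (hH.dir_iff.2 ⟨hab, ha, hb.1⟩)).trans hb.2⟩

variable [DecidableEq N]

theorem mem_cc : C ∈ G.cc ↔
    ∃ a ∈ G.verts, ∀ b, b ∈ C ↔ b ∈ G.verts ∧ Relation.ReflTransGen G.bi a b := by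
  classical
  simp [cc, Finset.ext_iff, iff_comm]

theorem subset_verts_of_mem_cc (hC : C ∈ G.cc) : C ⊆ G.verts := by
  obtain ⟨a, -, ha⟩ := mem_cc.1 hC
  exact fun b hb => ((ha b).1 hb).1

theorem mem_of_mem_cc_of_bi (hC : C ∈ G.cc) (ha : a ∈ C) (hb : b ∈ G.verts) (hab : G.bi a b) :
    b ∈ C := by
  obtain ⟨c, -, hc⟩ := mem_cc.1 hC
  exact (hc b).2 ⟨hb, ((hc a).1 ha).2.tail hab⟩

theorem pairwiseDisjoint_cc [Std.Symm G.bi] : (G.cc : Set (Finset N)).PairwiseDisjoint id := by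
  intro A hA B hB hAB
  refine Finset.disjoint_left.2 fun c hcA hcB => hAB ?_
  obtain ⟨a, -, ha⟩ := mem_cc.1 hA
  obtain ⟨b, -, hb⟩ := mem_cc.1 hB
  have hac : Relation.ReflTransGen G.bi a c := ((ha c).1 hcA).2
  have hbc : Relation.ReflTransGen G.bi b c := ((hb c).1 hcB).2
  have hab : Relation.ReflTransGen G.bi a b := hac.trans (Std.Symm.symm _ _ hbc)
  ext d
  rw [ha, hb]
  exact and_congr_right fun _ => ⟨(Std.Symm.symm _ _ hab).trans, hab.trans⟩

theorem IsInducedSubgraph.induce (hH : H.IsInducedSubgraph G) (W : Finset N) :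
    (H.induce W).IsInducedSubgraph G where
  verts_subset := Finset.inter_subset_left.trans hH.verts_subset
  dir_iff := by simp only [MixedGraph.induce, hH.dir_iff, Finset.mem_inter]; tauto
  bi_iff := by simp only [MixedGraph.induce, hH.bi_iff, Finset.mem_inter]; tauto

theorem verts_induce_of_subset (h : W ⊆ G.verts) : (G.induce W).verts = W :=
  Finset.inter_eq_right.2 h

theorem verts_del (G : MixedGraph N) (X : Finset N) : (G.del X).verts = G.verts \ X :=
  verts_induce_of_subset Finset.sdiff_subset

theorem IsAncestralIn.sdiff (h : G.IsAncestralIn A W) (X : Finset N) :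
    G.IsAncestralIn (A \ X) (W \ X) where
  subset := Finset.sdiff_subset_sdiff h.subset le_rfl
  mem_of_dir hb ha hab := by
    rw [Finset.mem_sdiff] at ha hb ⊢
    exact ⟨h.mem_of_dir hb.1 ha.1 hab, ha.2⟩

theorem IsInducedSubgraph.isAncestralIn_cutIncoming (hH : H.IsInducedSubgraph G)
    (X Y : Finset N) :
    G.IsAncestralIn ((H.verts \ X) ∩ (H.cutIncoming X).An Y) (H.verts \ X) where
  subset := Finset.inter_subset_left
  mem_of_dir hb ha hab := by
    rw [Finset.mem_inter] at hb ⊢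
    obtain ⟨hbW, hbX⟩ := Finset.mem_sdiff.1 hb.1
    have haW := (Finset.mem_sdiff.1 ha).1
    exact ⟨ha, mem_An_of_dir haW ⟨hH.dir_iff.2 ⟨hab, haW, hbW⟩, hbX⟩ hb.2⟩

theorem biUnion_cc (G : MixedGraph N) : G.cc.biUnion id = G.verts := by
  classical
  refine Finset.Subset.antisymm (Finset.biUnion_subset.2 fun C => subset_verts_of_mem_cc) ?_
  intro a ha
  refine Finset.mem_biUnion.2 ⟨_, Finset.mem_image_of_mem _ ha, ?_⟩
  exact Finset.mem_filter.2 ⟨ha, .refl⟩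

theorem verts_eq_of_cc_eq_singleton (h : G.cc = {C}) : G.verts = C := by
  rw [← biUnion_cc, h, Finset.singleton_biUnion, id]

end Subgraph

/-! ## d-separation from the selection variables -/

section DSeparation

open Relation

variable {N : Type*} {G : MixedGraph N}

theorem exists_openPath_of_transGen (hG : ∀ a, ¬ TransGen G.dir a a) {a b : N}
    (hab : TransGen G.dir a b) :
    ∃ l, G.OpenPath ∅ a l .fwd b ∧ ∀ c ∈ l, ReflTransGen G.dir c b := by
  induction hab with
  | @single b hab =>
    refine ⟨[b, a], .single hab fun h => hG a (.single (h ▸ hab)), ?_⟩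
    simp [ReflTransGen.refl, ReflTransGen.single hab]
  | @tail b c _ hbc ih =>
    obtain ⟨l, hl, hlb⟩ := ih
    refine ⟨c :: l, .snoc hl hbc (fun hc => hG c (.tail' (hlb c hc) hbc)) ?_, ?_⟩
    · exact ⟨fun hcol => absurd rfl hcol.2, fun _ => Finset.notMem_empty b⟩
    · exact List.forall_mem_cons.2 ⟨.refl, fun d hd => (hlb d hd).tail hbc⟩

theorem DSep.not_transGen {A B : Finset N} (h : G.DSep A B ∅)
    (hG : ∀ a, ¬ TransGen G.dir a a) {a b : N} (ha : a ∈ A) (hb : b ∈ B) :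
    ¬ TransGen G.dir a b := fun hab => by
  obtain ⟨l, hl, -⟩ := exists_openPath_of_transGen hG hab
  exact h a ha b hb l .fwd hl

variable {V ι : Type*} [Fintype V] {H : MixedGraph V} {Δ : ι → Finset V}

theorem exists_of_transGen_selectionDiagram {a : V} {y : V ⊕ V}
    (h : TransGen (H.selectionDiagram Δ).dir (.inl a) y) :
    ∃ b, y = .inl b ∧ TransGen H.dir a b := by
  induction h with
  | @single y h =>
    cases y with
    | inl b => exact ⟨b, rfl, .single h⟩
    | inr b => exact h.elim
  | @tail y z _ hyz ih =>
    obtain ⟨b, rfl, hab⟩ := ih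
    cases z with
    | inl c => exact ⟨c, rfl, hab.tail hyz⟩
    | inr c => exact hyz.elim

theorem not_transGen_selectionDiagram_self (hH : ∀ a, ¬ TransGen H.dir a a) (x : V ⊕ V) :
    ¬ TransGen (H.selectionDiagram Δ).dir x x := by
  intro h
  cases x with
  | inl a =>
    obtain ⟨b, hab, h'⟩ := exists_of_transGen_selectionDiagram h
    exact hH a (Sum.inl_injective hab ▸ h')
  | inr a =>
    obtain ⟨x, -, hx⟩ := TransGen.tail'_iff.1 h
    cases x <;> exact hx

theorem disjoint_An_of_dSep [DecidableEq V] (hH : ∀ a, ¬ TransGen H.dir a a) {i : ι}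
    {X Y : Finset V}
    (hsep : ((H.selectionDiagram Δ).del (obs X)).DSep (sel (Δ i)) (obs Y) ∅) :
    Disjoint ((H.del X).An Y) (Δ i) := by
  classical
  refine Finset.disjoint_left.2 fun a ha haΔ => ?_
  have hverts {b : V} (hb : b ∈ H.verts \ X) :
      Sum.inl b ∈ (H.selectionDiagram Δ).verts \ obs X := by
    simpa [selectionDiagram, obs] using hb
  have haX : a ∈ H.verts \ X := by
    rw [← verts_del]
    exact An_subset_verts _ _ ha
  obtain ⟨-, y, hy, hay⟩ := Finset.mem_filter.1 ha
  have hselect : ((H.selectionDiagram Δ).del (obs X)).dir (.inr a) (.inl a) := by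
    refine ⟨⟨rfl, (Finset.mem_sdiff.1 haX).1, i, haΔ⟩, ?_, hverts haX⟩
    simpa [selectionDiagram, obs] using ⟨i, haΔ⟩
  have hpath : ReflTransGen ((H.selectionDiagram Δ).del (obs X)).dir (.inl a) (.inl y) :=
    ReflTransGen.lift Sum.inl (fun b c hbc => ⟨hbc.1, hverts hbc.2.1, hverts hbc.2.2⟩) a y hay
  have hacyclic (x : V ⊕ V) : ¬ TransGen ((H.selectionDiagram Δ).del (obs X)).dir x x := fun h =>
    not_transGen_selectionDiagram_self hH x (TransGen.mono (fun _ _ hbc => hbc.1) x x h)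
  exact hsep.not_transGen hacyclic (Finset.mem_map_of_mem _ haΔ) (Finset.mem_map_of_mem _ hy)
    (.head' hselect hpath)

end DSeparation

end MixedGraph

/-! ## C-factors -/

namespace SCM

open MeasureTheory

section CFactor

variable {V : Type*} {Ω : V → Type*} {κ : Type*} {U : κ → Type*} [∀ k, MeasurableSpace (U k)]
  {M N : SCM Ω U} {A B W : Finset V}

instance (M : SCM Ω U) (k : κ) : IsProbabilityMeasure (M.μ k) := M.prob k

/-- The units for which the mechanisms of the variables in `W` agree with `v`. -/
def agreement (M : SCM Ω U) (W : Finset V) (v : Assign Ω) : Set (∀ k, U k) :=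
  {u | ∀ w ∈ W, M.f w v u = v w}

/-- The exogenous arguments of the mechanisms of the variables in `W`. -/
def exoOf (M : SCM Ω U) (W : Finset V) : Set κ :=
  ⋃ w ∈ W, M.exo w

theorem measurableSet_agreement (M : SCM Ω U) (W : Finset V) (v : Assign Ω) :
    MeasurableSet (M.agreement W v) := by
  simp only [agreement, Set.ofPred_forall]
  exact Finset.measurableSet_biInter _ fun w _ => M.f_meas w v (v w)

theorem dependsOn_mem_agreement (M : SCM Ω U) (W : Finset V) (v : Assign Ω) :
    DependsOn (· ∈ M.agreement W v) (M.exoOf W) := fun u u' h =>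
  propext <| forall₂_congr fun w hw => by
    rw [M.f_local w v v u u' (fun _ _ => rfl) fun k hk => h k (Set.mem_biUnion hw hk)]

theorem agreement_anti (h : A ⊆ W) (v : Assign Ω) : M.agreement W v ⊆ M.agreement A v :=
  fun _ hu w hw => hu w (h hw)

variable [Fintype κ]

/-- The c-factor `Q[W]`: the probability of the values of `W` after all other variables are set
to theirs. -/
noncomputable def cFactor (M : SCM Ω U) (W : Finset V) (v : Assign Ω) : ℝ :=
  (Measure.pi M.μ).real (M.agreement W v)

theorem cFactor_empty (M : SCM Ω U) (v : Assign Ω) : M.cFactor ∅ v = 1 := by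
  simp [cFactor, agreement]

theorem cFactor_nonneg (M : SCM Ω U) (W : Finset V) (v : Assign Ω) : 0 ≤ M.cFactor W v :=
  measureReal_nonneg

theorem cFactor_anti (h : A ⊆ W) (v : Assign Ω) : M.cFactor W v ≤ M.cFactor A v :=
  measureReal_mono (agreement_anti h v)

theorem cFactor_pos_of_subset (h : A ⊆ W) (hW : ∀ v, 0 < M.cFactor W v) (v : Assign Ω) :
    0 < M.cFactor A v :=
  (hW v).trans_le (cFactor_anti h v)

theorem cFactor_union [DecidableEq V] (h : Disjoint (M.exoOf A) (M.exoOf B)) (v : Assign Ω) :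
    M.cFactor (A ∪ B) v = M.cFactor A v * M.cFactor B v := by
  have hinter : M.agreement (A ∪ B) v = M.agreement A v ∩ M.agreement B v :=
    Set.ext fun u => Finset.forall_mem_union
  rw [cFactor, hinter]
  exact measureReal_pi_inter_of_dependsOn M.μ h (M.measurableSet_agreement A v)
    (M.measurableSet_agreement B v) (M.dependsOn_mem_agreement A v) (M.dependsOn_mem_agreement B v)

theorem cFactor_biUnion [DecidableEq V] {F : Finset (Finset V)}
    (hF : (F : Set (Finset V)).PairwiseDisjoint M.exoOf) (v : Assign Ω) :
    M.cFactor (F.biUnion id) v = ∏ C ∈ F, M.cFactor C v := by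
  induction F using Finset.induction_on with
  | empty => simp [cFactor_empty]
  | insert A F hA ih =>
    rw [Finset.coe_insert, Set.pairwiseDisjoint_insert_of_notMem (by simpa using hA)] at hF
    have hdisj : Disjoint (M.exoOf A) (M.exoOf (F.biUnion id)) := by
      simpa [exoOf, Set.disjoint_iUnion_right] using hF.2
    rw [Finset.prod_insert hA, Finset.biUnion_insert, ← ih hF.1]
    exact cFactor_union hdisj v

theorem cFactor_congr_model (hf : ∀ w ∈ W, N.f w = M.f w)
    (hμ : ∀ w ∈ W, ∀ k ∈ M.exo w, N.μ k = M.μ k) : N.cFactor W = M.cFactor W := by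
  funext v
  have hagree : N.agreement W v = M.agreement W v :=
    Set.ext fun u => forall₂_congr fun w hw => by rw [hf w hw]
  rw [cFactor, hagree]
  refine measureReal_pi_congr_of_dependsOn N.μ M.μ (fun k hk => ?_)
    (M.measurableSet_agreement W v) (M.dependsOn_mem_agreement W v)
  obtain ⟨w, hw, hkw⟩ := Set.mem_iUnion₂.1 hk
  exact hμ w hw k hkw

end CFactor

end SCM

theorem CausalDiagram.wellFounded_dir {V : Type*} [Fintype V] (G : CausalDiagram V) :
    WellFounded G.dir := by
  have : Std.Irrefl (Relation.TransGen G.dir) := ⟨G.acyclic⟩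
  exact WellFounded.mono (Finite.wellFounded_of_trans_of_irrefl (Relation.TransGen G.dir))
    fun _ _ => Relation.TransGen.single

namespace SCM.CompatibleWith

open MeasureTheory

section Solutions

variable {V : Type*} [Fintype V] {Ω : V → Type*} {κ : Type*} {U : κ → Type*}
  [∀ k, MeasurableSpace (U k)] {M : SCM Ω U} {G : CausalDiagram V} {A B T W : Finset V}
  {u : ∀ k, U k} {v w s t : Assign Ω}

theorem disjoint_exoOf (hM : M.CompatibleWith G) (hAB : Disjoint A B)
    (hbi : ∀ a ∈ A, ∀ b ∈ B, ¬ G.bi a b) : Disjoint (M.exoOf A) (M.exoOf B) := by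
  refine Set.disjoint_left.2 fun k hkA hkB => ?_
  obtain ⟨a, ha, hka⟩ := Set.mem_iUnion₂.1 hkA
  obtain ⟨b, hb, hkb⟩ := Set.mem_iUnion₂.1 hkB
  have hab : a ≠ b := fun h => Finset.disjoint_left.1 hAB ha (h ▸ hb)
  exact hbi a ha b hb (hM.2 a b hab ⟨k, hka, hkb⟩)

theorem agreement_congr (hM : M.CompatibleWith G) (hW : ∀ a ∈ W, v a = w a)
    (hpa : ∀ b ∈ W, ∀ a, G.dir a b → v a = w a) : M.agreement W v = M.agreement W w :=
  Set.ext fun u => forall₂_congr fun b hb => by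
    rw [M.f_local b v w u u (fun a ha => hpa b hb a (hM.1 b a ha)) fun _ _ => rfl, hW b hb]

theorem cFactor_congr_assign [Fintype κ] (hM : M.CompatibleWith G) (hW : ∀ a ∈ W, v a = w a)
    (hpa : ∀ b ∈ W, ∀ a, G.dir a b → v a = w a) : M.cFactor W v = M.cFactor W w := by
  rw [cFactor, cFactor, hM.agreement_congr hW hpa]

theorem solution_unique (hM : M.CompatibleWith G) (hst : ∀ a ∉ T, s a = t a)
    (hs : u ∈ M.agreement T s) (ht : u ∈ M.agreement T t) : s = t := by
  funext a
  induction a using G.wellFounded_dir.induction with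
  | _ a ih =>
    by_cases ha : a ∈ T
    · rw [← hs a ha, ← ht a ha]
      exact M.f_local a s t u u (fun w hw => ih w (hM.1 a w hw)) fun _ _ => rfl
    · exact hst a ha

theorem solution_exists (hM : M.CompatibleWith G) (T : Finset V) (u : ∀ k, U k)
    (v : Assign Ω) : ∃ s : Assign Ω, (∀ a ∉ T, s a = v a) ∧ u ∈ M.agreement T s := by
  classical
  let F : ∀ a, (∀ b, G.dir b a → Ω b) → Ω a := fun a r =>
    if a ∈ T then M.f a (fun b => if h : G.dir b a then r b h else v b) u else v a
  let s : Assign Ω := G.wellFounded_dir.fix F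
  have hs (a : V) : s a = F a fun b _ => s b := G.wellFounded_dir.fix_eq F a
  refine ⟨s, fun a ha => by rw [hs]; simp [F, ha], fun a ha => ?_⟩
  rw [hs a]
  simp only [F, ha, if_true]
  refine M.f_local a _ _ u u (fun w hw => ?_) fun _ _ => rfl
  simp [hM.1 a w hw]

end Solutions

section Marginal

variable {V : Type*} [Fintype V] [DecidableEq V] {Ω : V → Type*} [∀ v, Fintype (Ω v)]
  {κ : Type*} [Fintype κ] {U : κ → Type*} [∀ k, MeasurableSpace (U k)] {M : SCM Ω U}
  {G : CausalDiagram V} {A T W : Finset V}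

theorem marginal_cFactor_eq_measureReal (hM : M.CompatibleWith G) (hT : T ⊆ W)
    (v : Assign Ω) :
    marginal T (M.cFactor W) v =
      (Measure.pi M.μ).real {u | ∃ s, (∀ a ∉ T, s a = v a) ∧ u ∈ M.agreement W s} := by
  classical
  simp only [marginal, cFactor]
  rw [← measureReal_biUnion_finset _ fun s _ => M.measurableSet_agreement W s]
  · congr 1
    ext u
    simp
  · intro s hs t ht hne
    simp only [Finset.coe_filter_univ, Set.mem_ofPred_eq] at hs ht
    refine Set.disjoint_left.2 fun u hus hut => hne ?_
    exact hM.solution_unique (fun a ha => (hs a ha).trans (ht a ha).symm)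
      (agreement_anti hT s hus) (agreement_anti hT t hut)

theorem marginal_cFactor (hM : M.CompatibleWith G) (hA : G.IsAncestralIn A W) (v : Assign Ω) :
    marginal (W \ A) (M.cFactor W) v = M.cFactor A v := by
  have hcongr {s : Assign Ω} (hs : ∀ a ∉ W \ A, s a = v a) :
      M.agreement A s = M.agreement A v :=
    hM.agreement_congr (fun a ha => hs a fun h => (Finset.mem_sdiff.1 h).2 ha)
      fun b hb a hab => hs a fun h =>
        (Finset.mem_sdiff.1 h).2 (hA.mem_of_dir hb (Finset.mem_sdiff.1 h).1 hab)
  rw [hM.marginal_cFactor_eq_measureReal Finset.sdiff_subset, cFactor]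
  congr 1
  ext u
  constructor
  · rintro ⟨s, hs, hu⟩
    exact hcongr hs ▸ agreement_anti hA.subset s hu
  · intro hu
    obtain ⟨s, hs, hsu⟩ := hM.solution_exists (W \ A) u v
    refine ⟨s, hs, fun a ha => ?_⟩
    by_cases haA : a ∈ A
    · exact (hcongr hs ▸ hu) a haA
    · exact hsu a (Finset.mem_sdiff.2 ⟨ha, haA⟩)

theorem cFactor_sdiff_le (hM : M.CompatibleWith G) (X W : Finset V) (v : Assign Ω) :
    M.cFactor (W \ X) v ≤ M.cFactor W v + 1 - marginal (W \ X) (M.cFactor W) v := by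
  rw [hM.marginal_cFactor_eq_measureReal Finset.sdiff_subset]
  set F := {u | ∃ s, (∀ a ∉ W \ X, s a = v a) ∧ u ∈ M.agreement W s}
  have hinter : M.agreement (W \ X) v ∩ F ⊆ M.agreement W v := by
    rintro u ⟨hu, s, hs, hus⟩
    exact hM.solution_unique hs (agreement_anti Finset.sdiff_subset s hus) hu ▸ hus
  have hle : (Measure.pi M.μ).real (M.agreement (W \ X) v ∩ F) ≤ M.cFactor W v :=
    measureReal_mono hinter
  have hunion : (Measure.pi M.μ).real (M.agreement (W \ X) v ∪ F) ≤ 1 := measureReal_le_one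
  have hadd := measureReal_union_add_inter' (μ := Measure.pi M.μ)
    (M.measurableSet_agreement (W \ X) v) (t := F)
  rw [cFactor]
  linarith

end Marginal

section Components

open MixedGraph

variable {V : Type*} [Fintype V] [DecidableEq V] {Ω : V → Type*} {κ : Type*} [Fintype κ]
  {U : κ → Type*} [∀ k, MeasurableSpace (U k)] {M : SCM Ω U} {G : CausalDiagram V}
  {H : MixedGraph V} {A K : Finset V}

theorem cFactor_eq_inter_mul_sdiff (hM : M.CompatibleWith G)
    (hH : H.IsInducedSubgraph G.toMixedGraph) (hK : K ∈ H.cc) (hA : A ⊆ H.verts) (v : Assign Ω) :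
    M.cFactor A v = M.cFactor (A ∩ K) v * M.cFactor (A \ K) v := by
  have hdisj : Disjoint (M.exoOf (A ∩ K)) (M.exoOf (A \ K)) := by
    refine hM.disjoint_exoOf (Finset.disjoint_sdiff_inter A K).symm fun a ha b hb hab => ?_
    obtain ⟨haA, haK⟩ := Finset.mem_inter.1 ha
    obtain ⟨hbA, hbK⟩ := Finset.mem_sdiff.1 hb
    exact hbK (mem_of_mem_cc_of_bi hK haK (hA hbA) (hH.bi_iff.2 ⟨hab, hA haA, hA hbA⟩))
  rw [← cFactor_union hdisj, Finset.union_comm, Finset.sdiff_union_inter]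

theorem cFactor_verts_eq_prod_cc (hM : M.CompatibleWith G)
    (hH : H.IsInducedSubgraph G.toMixedGraph) (v : Assign Ω) :
    M.cFactor H.verts v = ∏ C ∈ H.cc, M.cFactor C v := by
  have := hH.symm_bi G.bi_symm
  rw [← cFactor_biUnion, biUnion_cc]
  intro A hA B hB hAB
  have hdisj : Disjoint A B := pairwiseDisjoint_cc hA hB hAB
  refine hM.disjoint_exoOf hdisj fun a ha b hb hab => Finset.disjoint_right.1 hdisj hb ?_
  have haH := subset_verts_of_mem_cc hA ha
  have hbH := subset_verts_of_mem_cc hB hb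
  exact mem_of_mem_cc_of_bi hA ha hbH (hH.bi_iff.2 ⟨hab, haH, hbH⟩)

end Components

end SCM.CompatibleWith

/-! ## Interventional queries -/

namespace SCM

open MixedGraph

variable {V : Type*} [Fintype V] [DecidableEq V] {Ω : V → Type*} [∀ v, Fintype (Ω v)] {κ : Type*}
  [Fintype κ] {U : κ → Type*} [∀ k, MeasurableSpace (U k)] {M : SCM Ω U} {G : CausalDiagram V}
  {H : MixedGraph V} {A R W Y : Finset V}

/-- The probability of the values of `Y` after the variables outside of `W` are set to theirs. With
`W` the complement of `X`, this is `P_x(y)`; the procedures query smaller sets `W` as well. -/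
noncomputable def query (M : SCM Ω U) (Y W : Finset V) (v : Assign Ω) : ℝ :=
  marginal (W \ Y) (M.cFactor W) v

theorem CompatibleWith.doProb_eq_query (hM : M.CompatibleWith G) (X Y : Finset V)
    (v : Assign Ω) : M.doProb X Y v = M.query Y Xᶜ v := by
  rw [query, hM.marginal_cFactor_eq_measureReal Finset.sdiff_subset, doProb]
  congr 1
  ext u
  refine exists_congr fun s => ?_
  simp only [IsSolution, agreement, Set.mem_ofPred_eq, Finset.mem_sdiff, Finset.mem_compl]
  grind

theorem query_pos (Y : Finset V) (hW : ∀ v, 0 < M.cFactor W v) (v : Assign Ω) :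
    0 < M.query Y W v :=
  marginal_pos hW v

theorem query_self (M : SCM Ω U) (W : Finset V) (v : Assign Ω) :
    M.query W W v = M.cFactor W v := by
  rw [query, Finset.sdiff_self, marginal_empty]

theorem query_sdiff (M : SCM Ω U) (X Y W : Finset V) (v : Assign Ω) :
    M.query Y (W \ X) v = marginal (W \ (Y ∪ X)) (M.cFactor (W \ X)) v := by
  rw [query, sdiff_sdiff_left, Finset.sup_eq_union, Finset.union_comm]

theorem query_mergeOn (hR : R ⊆ W \ Y) (w v : Assign Ω) :
    M.query Y W (mergeOn R w v) = M.query Y W v :=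
  marginal_congr_assign _ fun _ ha => if_neg fun h => ha (hR h)

namespace CompatibleWith

theorem query_eq_of_isAncestralIn (hM : M.CompatibleWith G) (hA : G.IsAncestralIn A W)
    (hY : W ∩ Y ⊆ A) (v : Assign Ω) : M.query Y W v = M.query Y A v := by
  have hAW := hA.subset
  have hset : W \ Y = (A \ Y) ∪ (W \ A) := by grind
  have hdisj : Disjoint (A \ Y) (W \ A) := Finset.disjoint_sdiff.mono_left Finset.sdiff_subset
  rw [query, hset, ← marginal_marginal hdisj, funext (hM.marginal_cFactor hA), query]

theorem query_An (hM : M.CompatibleWith G) (hH : H.IsInducedSubgraph G.toMixedGraph)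
    (X Y : Finset V) (v : Assign Ω) :
    M.query Y (H.verts \ X) v = M.query Y (H.An Y \ X) v := by
  refine hM.query_eq_of_isAncestralIn ((hH.isAncestralIn_An Y).sdiff X) (fun a ha => ?_) v
  obtain ⟨haW, haY⟩ := Finset.mem_inter.1 ha
  obtain ⟨haH, haX⟩ := Finset.mem_sdiff.1 haW
  exact Finset.mem_sdiff.2 ⟨mem_An_of_mem haH haY, haX⟩

theorem query_extend (hM : M.CompatibleWith G) (hH : H.IsInducedSubgraph G.toMixedGraph)
    (X Y : Finset V) (hR : R = (H.verts \ X) \ (H.cutIncoming X).An Y) (w v : Assign Ω) :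
    M.query Y (H.verts \ X) v = M.query Y (H.verts \ (X ∪ R)) (mergeOn R w v) := by
  have hYAn : (H.verts \ X) ∩ Y ⊆ (H.cutIncoming X).An Y := fun a ha => by
    obtain ⟨haW, haY⟩ := Finset.mem_inter.1 ha
    exact mem_An_of_mem (Finset.mem_sdiff.1 haW).1 haY
  have hRY : R ⊆ (H.verts \ X) \ Y := by grind
  have hset : H.verts \ (X ∪ R) = (H.verts \ X) ∩ (H.cutIncoming X).An Y := by grind
  rw [← query_mergeOn hRY w v, hset]
  exact hM.query_eq_of_isAncestralIn (hH.isAncestralIn_cutIncoming X Y)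
    (Finset.subset_inter Finset.inter_subset_left hYAn) _

end CompatibleWith

end SCM

/-! ## Identification of c-factors -/

section Telescope

variable {α β G₀ : Type*} [LinearOrder β] [CommGroupWithZero G₀]
  {q : Finset α → G₀} {π : α → β} {K : Finset α}

theorem prod_div_filter_lt (hπ : Set.InjOn π K) (hq : ∀ A ⊆ K, q A ≠ 0) :
    ∏ i ∈ K, q (K.filter fun a => π a ≤ π i) / q (K.filter fun a => π a < π i) = q K / q ∅ := by
  classical
  induction K using Finset.induction_on_max_value π with
  | empty => simp [hq ∅ le_rfl]
  | insert a s ha hmax ih =>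
    have hs : s ⊆ insert a s := Finset.subset_insert a s
    have hlt : ∀ x ∈ s, π x < π a := fun x hx => (hmax x hx).lt_of_ne fun h =>
      ha (hπ (by simp [hx]) (by simp) h ▸ hx)
    have hle_max : (insert a s).filter (fun x => π x ≤ π a) = insert a s := by grind
    have hlt_max : (insert a s).filter (fun x => π x < π a) = s := by grind
    have hrest : ∏ i ∈ s, q ((insert a s).filter fun x => π x ≤ π i) /
        q ((insert a s).filter fun x => π x < π i) = q s / q ∅ := by
      rw [← ih (hπ.mono (Finset.coe_subset.2 hs)) fun A hA => hq A (hA.trans hs)]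
      refine Finset.prod_congr rfl fun i hi => ?_
      rw [Finset.filter_insert, Finset.filter_insert, if_neg (hlt i hi).not_ge,
        if_neg (hlt i hi).not_gt]
    rw [Finset.prod_insert ha, hle_max, hlt_max, hrest, div_mul_div_cancel₀ (hq s hs)]

end Telescope

namespace Expression

open MixedGraph

variable {V ι : Type*} [Fintype V] [DecidableEq V] {Ω : V → Type*} [∀ v, Fintype (Ω v)]
  {𝒵 : ι → Finset (Finset V)} {κ : Type*} [Fintype κ] {U : κ → Type*}
  [∀ k, MeasurableSpace (U k)] {M : SCM Ω U} {G : CausalDiagram V} {H : MixedGraph V}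
  {π : V → ℕ} {K : Finset V} {P : Expression Ω 𝒵} {D : ExpData Ω 𝒵}

theorem sum_filter_le_eq_cFactor (hM : M.CompatibleWith G)
    (hH : H.IsInducedSubgraph G.toMixedGraph) (hπ : IsTopologicalOrder H π)
    (hP : P D = M.cFactor H.verts) (n : ℕ) (v : Assign Ω) :
    Expression.sum (H.verts.filter fun a => n ≤ π a) P D v =
      M.cFactor (H.verts.filter fun a => π a < n) v := by
  have hset : (H.verts.filter fun a => n ≤ π a) = H.verts \ H.verts.filter fun a => π a < n := by
    grind
  rw [sum_eq_marginal, hP, hset, hM.marginal_cFactor (hH.isAncestralIn_filter_lt hπ n)]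

theorem cond_eq_div (hM : M.CompatibleWith G) (hH : H.IsInducedSubgraph G.toMixedGraph)
    (hπ : IsTopologicalOrder H π) (hP : P D = M.cFactor H.verts) (i : V) (v : Assign Ω) :
    cond H.verts π P i D v =
      M.cFactor (H.verts.filter fun a => π a ≤ π i) v /
        M.cFactor (H.verts.filter fun a => π a < π i) v := by
  have hnum := sum_filter_le_eq_cFactor hM hH hπ hP (π i + 1) v
  simp only [Nat.add_one_le_iff, Nat.lt_add_one_iff] at hnum
  rw [cond, hnum, sum_filter_le_eq_cFactor hM hH hπ hP]

theorem cond_eq_div_of_mem_cc (hM : M.CompatibleWith G)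
    (hH : H.IsInducedSubgraph G.toMixedGraph) (hπ : IsTopologicalOrder H π) (hK : K ∈ H.cc)
    (hP : P D = M.cFactor H.verts) (hpos : ∀ v, 0 < M.cFactor H.verts v) {i : V} (hi : i ∈ K)
    (v : Assign Ω) :
    cond H.verts π P i D v =
      M.cFactor (K.filter fun a => π a ≤ π i) v / M.cFactor (K.filter fun a => π a < π i) v := by
  have hKH := subset_verts_of_mem_cc hK
  have hinter (p : V → Prop) [DecidablePred p] : H.verts.filter p ∩ K = K.filter p := by grind
  have hsdiff : (H.verts.filter fun a => π a ≤ π i) \ K =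
      (H.verts.filter fun a => π a < π i) \ K := by
    ext a
    have hne (haH : a ∈ H.verts) (haK : a ∉ K) : π a ≠ π i := fun h =>
      haK (hπ.1 haH (hKH hi) h ▸ hi)
    grind
  have hne : M.cFactor ((H.verts.filter fun a => π a < π i) \ K) v ≠ 0 :=
    (SCM.cFactor_pos_of_subset (Finset.sdiff_subset.trans (Finset.filter_subset _ _)) hpos v).ne'
  have hsplit (p : V → Prop) [DecidablePred p] :=
    hM.cFactor_eq_inter_mul_sdiff hH hK (Finset.filter_subset p H.verts) v
  rw [cond_eq_div hM hH hπ hP, hsplit, hsplit, hinter, hinter, hsdiff, mul_div_mul_right _ _ hne]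

theorem condProd_eq_cFactor (hM : M.CompatibleWith G)
    (hH : H.IsInducedSubgraph G.toMixedGraph) (hπ : IsTopologicalOrder H π) (hK : K ∈ H.cc)
    (hP : P D = M.cFactor H.verts) (hpos : ∀ v, 0 < M.cFactor H.verts v) :
    condProd H.verts π P K D = M.cFactor K := by
  funext v
  have hKH := subset_verts_of_mem_cc hK
  have htelescope := prod_div_filter_lt (q := (M.cFactor · v))
    (hπ.1.mono (Finset.coe_subset.2 hKH))
    fun A hA => (SCM.cFactor_pos_of_subset (hA.trans hKH) hpos v).ne'
  rw [condProd, Finset.prod_congr rfl fun i hi => cond_eq_div_of_mem_cc hM hH hπ hK hP hpos hi v,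
    htelescope, SCM.cFactor_empty, div_one]

end Expression

/-! ## Soundness -/

namespace BoundType

/-- `e` is a bound for `q` of the given type. Lower bounds are required to be positive, both to
multiply them and because `[e, 1]` is to be different from `[0, 1]`. -/
def IsBound : BoundType → ℝ → ℝ → Prop
  | .lower, e, q => 0 < e ∧ e ≤ q
  | .upper, e, q => q ≤ e

variable {t : BoundType}

theorem IsBound.of_eq {e q : ℝ} (h : e = q) (hq : 0 < q) : t.IsBound e q := by
  cases t
  · exact ⟨h ▸ hq, h.le⟩
  · exact h.ge

theorem IsBound.marginal {V : Type*} [Fintype V] [DecidableEq V] {Ω : V → Type*}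
    [∀ v, Fintype (Ω v)] {e q : Assign Ω → ℝ} (h : ∀ v, t.IsBound (e v) (q v)) (T : Finset V)
    (v : Assign Ω) : t.IsBound (marginal T e v) (marginal T q v) := by
  cases t
  · exact ⟨marginal_pos (fun w => (h w).1) v, marginal_mono (fun w => (h w).2) v⟩
  · exact marginal_mono h v

theorem IsBound.prod {α : Type*} {s : Finset α} {e q : α → ℝ} (hq : ∀ a ∈ s, 0 ≤ q a)
    (h : ∀ a ∈ s, t.IsBound (e a) (q a)) : t.IsBound (∏ a ∈ s, e a) (∏ a ∈ s, q a) := by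
  cases t
  · exact ⟨Finset.prod_pos fun a ha => (h a ha).1,
      Finset.prod_le_prod (fun a ha => (h a ha).1.le) fun a ha => (h a ha).2⟩
  · exact Finset.prod_le_prod hq h

end BoundType

section Soundness

open MixedGraph

variable {V ι : Type*} [Fintype V] [DecidableEq V] {Ω : V → Type*} [∀ v, Fintype (Ω v)]
  {𝒵 : ι → Finset (Finset V)} {t : BoundType} {X Y W : Finset V} {H : MixedGraph V}
  {P e : Expression Ω 𝒵} {G : CausalDiagram V} {Δ Δ' : ι → Finset V}

section Identification

variable {κ : Type*} [Fintype κ] {U : κ → Type*} [∀ k, MeasurableSpace (U k)] {M : SCM Ω U}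
  {D : ExpData Ω 𝒵}

theorem naturalBound_isBound (hM : M.CompatibleWith G) (hP : P D = M.cFactor W)
    (hpos : ∀ v, 0 < M.cFactor W v) (t : BoundType) (X Y : Finset V) (v : Assign Ω) :
    t.IsBound (naturalBound Y X W P t D v) (M.query Y (W \ X) v) := by
  rw [SCM.query_sdiff]
  cases t
  · simp only [naturalBound, Expression.sum_eq_marginal, hP]
    exact ⟨marginal_pos hpos v, marginal_mono (SCM.cFactor_anti Finset.sdiff_subset) v⟩
  · simp only [naturalBound, Expression.sum_eq_marginal, hP]
    exact marginal_mono (hM.cFactor_sdiff_le X W) v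

theorem sum_prod_cc_isBound (hM : M.CompatibleWith G) (hH : H.IsInducedSubgraph G.toMixedGraph)
    {E : Finset V → Expression Ω 𝒵}
    (hE : ∀ C ∈ (H.del X).cc, ∀ v, t.IsBound (E C D v) (M.cFactor C v)) (Y : Finset V)
    (v : Assign Ω) :
    t.IsBound
      (Expression.sum (H.verts \ (Y ∪ X)) (fun D v => ∏ C ∈ (H.del X).cc, E C D v) D v)
      (M.query Y (H.verts \ X) v) := by
  have hdel : (H.del X).IsInducedSubgraph G.toMixedGraph := hH.induce _
  rw [SCM.query_sdiff, Expression.sum_eq_marginal]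
  refine .marginal (fun w => ?_) _ v
  rw [← verts_del, hM.cFactor_verts_eq_prod_cc hdel]
  exact .prod (fun C _ => SCM.cFactor_nonneg M C w) fun C hC => hE C hC w

theorem PaID.isBound (h : PaID t Y X P H e) (hM : M.CompatibleWith G)
    (hH : H.IsInducedSubgraph G.toMixedGraph) (hP : P D = M.cFactor H.verts)
    (hpos : ∀ v, 0 < M.cFactor H.verts v) (v : Assign Ω) :
    t.IsBound (e D v) (M.query Y (H.verts \ X) v) := by
  induction h with
  | noIntervention hX =>
    refine .of_eq ?_ (SCM.query_pos Y (SCM.cFactor_pos_of_subset Finset.sdiff_subset hpos) v)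
    rw [hX, Finset.sdiff_empty, Expression.sum_eq_marginal, hP, SCM.query]
  | @ancestors X P H e _ _ _ ih =>
    have hset : H.An Y \ (X ∩ H.An Y) = H.An Y \ X := by grind
    rw [verts_induce_of_subset (An_subset_verts H Y), hset] at ih
    rw [hM.query_An hH]
    refine ih (hH.induce _) ?_ (SCM.cFactor_pos_of_subset (An_subset_verts H Y) hpos)
    rw [← funext (hM.marginal_cFactor (hH.isAncestralIn_An Y)), ← hP]
    rfl
  | natural => exact naturalBound_isBound hM hP hpos t _ Y v
  | @component X P H C π _ _ _ hC hπ hCcc =>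
    have hCX : H.verts \ X = C := verts_del H X ▸ verts_eq_of_cc_eq_singleton hC
    refine .of_eq ?_ (SCM.query_pos Y (SCM.cFactor_pos_of_subset Finset.sdiff_subset hpos) v)
    rw [hCX, Expression.sum_eq_marginal, Expression.condProd_eq_cFactor hM hH hπ hCcc hP hpos,
      SCM.query]
  | @subcomponent X P H e C K π _ _ _ hC hπ hCK hK _ ih =>
    have hKH := subset_verts_of_mem_cc hK
    have hCX : H.verts \ X = C := verts_del H X ▸ verts_eq_of_cc_eq_singleton hC
    have hset : K \ (X ∩ K) = H.verts \ X := by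
      have := hCK.subset
      grind
    rw [verts_induce_of_subset hKH, hset] at ih
    exact ih (hH.induce _) (Expression.condProd_eq_cFactor hM hH hπ hK hP hpos)
      (SCM.cFactor_pos_of_subset hKH hpos)

end Identification

section Transport

variable {𝓜 : ModelCollection Ω ι}

theorem ModelCollection.Induces.query_congr (h : 𝓜.Induces G Δ) {i : ι} (hW : Disjoint W (Δ i))
    (Y : Finset V) (v : Assign Ω) :
    (𝓜.source i).query Y W v = 𝓜.target.query Y W v := by
  have hagree (a : V) (ha : a ∈ W) := h.2.2 i a (Finset.disjoint_left.1 hW ha)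
  rw [SCM.query, SCM.query, SCM.cFactor_congr_model (fun a ha => (hagree a ha).1)
    fun a ha => (hagree a ha).2.2]

theorem ModelCollection.Induces.query_eq_of_dSep (h : 𝓜.Induces G Δ)
    (hH : H.IsInducedSubgraph G.toMixedGraph) {i : ι} (hΔ : Δ i ∩ H.verts ⊆ Δ' i)
    (hsep : ((H.selectionDiagram Δ').del (obs X)).DSep (sel (Δ' i)) (obs Y) ∅) (v : Assign Ω) :
    (𝓜.source i).query Y (H.verts \ X) v = 𝓜.target.query Y (H.verts \ X) v := by
  have hdel : (H.del X).IsInducedSubgraph G.toMixedGraph := hH.induce _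
  have hanc := hdel.isAncestralIn_An Y
  have hY : (H.del X).verts ∩ Y ⊆ (H.del X).An Y := fun a ha =>
    mem_An_of_mem (Finset.mem_inter.1 ha).1 (Finset.mem_inter.1 ha).2
  have hdisj : Disjoint ((H.del X).An Y) (Δ i) := by
    have hAn : (H.del X).An Y ⊆ H.verts := hanc.subset.trans (by simp [verts_del])
    have := disjoint_An_of_dSep (hH.not_transGen_dir_self G.acyclic) hsep
    grind [Finset.disjoint_left]
  rw [← verts_del, (h.2.1 i).query_eq_of_isAncestralIn hanc hY,
    h.1.query_eq_of_isAncestralIn hanc hY, h.query_congr hdisj]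

theorem ModelCollection.experiment_eq_cFactor {i : ι} (hM : (𝓜.source i).CompatibleWith G)
    (Z : {Z : Finset V // Z ∈ 𝒵 i}) (hW : G.IsAncestralIn W Finset.univ) (z : Assign Ω) :
    Expression.experiment i Z W z (𝓜.data 𝒵) = (𝓜.source i).cFactor (W \ Z.1) := by
  funext v
  have hdata : 𝓜.data 𝒵 i Z = (𝓜.source i).cFactor Z.1ᶜ := by
    funext w
    rw [data, hM.doProb_eq_query, SCM.query_self]
  have hset : (W ∪ Z.1)ᶜ = Z.1ᶜ \ (W \ Z.1) := by grind [Finset.mem_compl]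
  have hanc : G.IsAncestralIn (W \ Z.1) Z.1ᶜ := Finset.compl_eq_univ_sdiff Z.1 ▸ hW.sdiff Z.1
  have hmerge {a : V} (ha : a ∈ W) : mergeOn W v z a = v a := if_pos ha
  rw [Expression.experiment, Expression.sum_eq_marginal, hdata, hset, hM.marginal_cFactor hanc]
  refine hM.cFactor_congr_assign (fun a ha => hmerge (Finset.mem_sdiff.1 ha).1) fun b hb a hab => ?_
  exact hmerge (hW.mem_of_dir (Finset.mem_sdiff.1 hb).1 (Finset.mem_univ a) hab)

theorem ModelCollection.Positive.experiment_pos (hpos : 𝓜.Positive 𝒵) {i : ι}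
    (Z : {Z : Finset V // Z ∈ 𝒵 i}) (W : Finset V) (z v : Assign Ω) :
    0 < Expression.experiment i Z W z (𝓜.data 𝒵) v :=
  marginal_pos (hpos i Z) _

theorem PaID.isBound_experiment {i : ι} {Z : {Z : Finset V // Z ∈ 𝒵 i}} {z : Assign Ω}
    (h : PaID t Y (X \ Z.1) (Expression.experiment i Z H.verts z) (H.del (Z.1 ∩ X)) e)
    (hZX : Z.1 ∩ H.verts ⊆ X) (hM : (𝓜.source i).CompatibleWith G) (hpos : 𝓜.Positive 𝒵)
    (hH : H.IsInducedSubgraph G.toMixedGraph) (hanc : G.IsAncestralIn H.verts Finset.univ)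
    (v : Assign Ω) :
    t.IsBound (e (𝓜.data 𝒵) v) ((𝓜.source i).query Y (H.verts \ X) v) := by
  have hverts : (H.del (Z.1 ∩ X)).verts = H.verts \ Z.1 := by
    rw [verts_del]
    grind
  have hset : (H.verts \ Z.1) \ (X \ Z.1) = H.verts \ X := by grind
  have hexperiment : Expression.experiment i Z H.verts z (𝓜.data 𝒵) =
      (𝓜.source i).cFactor (H.del (Z.1 ∩ X)).verts :=
    hverts ▸ ModelCollection.experiment_eq_cFactor hM Z hanc z
  have hbound := h.isBound hM (hH.induce _) hexperiment
    (hexperiment ▸ hpos.experiment_pos Z H.verts z) v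
  rwa [hverts, hset] at hbound

theorem PaTR.isBound (h : PaTR t Y X H Δ' e) (hM : 𝓜.Induces G Δ) (hpos : 𝓜.Positive 𝒵)
    (hH : H.IsInducedSubgraph G.toMixedGraph) (hanc : G.IsAncestralIn H.verts Finset.univ)
    (hΔ : ∀ i, Δ i ∩ H.verts ⊆ Δ' i) (v : Assign Ω) :
    t.IsBound (e (𝓜.data 𝒵) v) (𝓜.target.query Y (H.verts \ X) v) := by
  induction h generalizing v with
  | @direct Y X H Δ' i Z z hX hsep =>
    have hset : H.verts \ Z.1 = H.verts \ X := by grind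
    have hexperiment := ModelCollection.experiment_eq_cFactor (hM.2.1 i) Z hanc z
    rw [hset] at hexperiment
    rw [← hM.query_eq_of_dSep hH (hΔ i) hsep]
    refine .of_eq ?_ (SCM.query_pos Y (hexperiment ▸ hpos.experiment_pos Z H.verts z) v)
    rw [SCM.query_sdiff, Expression.sum_eq_marginal, hexperiment]
  | @nonAncestors Y X H Δ' e R hR _ _ ih =>
    have hAn := An_subset_verts H Y
    have hverts : (H.del R).verts = H.An Y := by
      rw [verts_del, hR, Finset.sdiff_sdiff_eq_self hAn]
    have hset : H.An Y \ (X \ R) = H.An Y \ X := by grind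
    rw [hverts, hset] at ih
    rw [hM.1.query_An hH]
    refine ih (hH.induce _) ((hH.isAncestralIn_An Y).trans hanc) (fun i a ha => ?_) v
    have := @hΔ i a
    grind
  | extend R w _ hR _ _ ih =>
    rw [hM.1.query_extend hH _ _ hR w]
    exact ih hH hanc hΔ _
  | @factorize Y X H Δ' E _ _ _ _ ih =>
    have hcomponent (C : Finset V) (hC : C ∈ (H.del X).cc) (w : Assign Ω) :
        t.IsBound (E C (𝓜.data 𝒵) w) (𝓜.target.cFactor C w) := by
      have hCX : C ⊆ H.verts \ X := verts_del H X ▸ subset_verts_of_mem_cc hC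
      have hbound := ih C hC hH hanc hΔ w
      rwa [Finset.sdiff_sdiff_eq_self (hCX.trans Finset.sdiff_subset), SCM.query_self] at hbound
    exact sum_prod_cc_isBound hM.1 hH hcomponent Y v
  | @identify Y X H Δ' e i Z z _ _ _ hΔi hZX hID =>
    have hdisj : Disjoint (H.verts \ X) (Δ i) := by
      have := hΔ i
      rw [← Finset.disjoint_iff_inter_eq_empty] at hΔi
      grind [Finset.disjoint_left]
    rw [← hM.query_congr hdisj]
    exact hID.isBound_experiment hZX (hM.2.1 i) hpos hH hanc v

theorem PaTR.isBound_doProb (h : PaTR t Y X G.toMixedGraph Δ e) (hM : 𝓜.Induces G Δ)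
    (hpos : 𝓜.Positive 𝒵) (v : Assign Ω) :
    t.IsBound (e (𝓜.data 𝒵) v) (𝓜.target.doProb X Y v) := by
  have hG : G.IsInducedSubgraph G.toMixedGraph :=
    ⟨le_rfl, by simp [G.verts_eq], by simp [G.verts_eq]⟩
  have hanc : G.IsAncestralIn G.verts Finset.univ := ⟨by simp, by simp [G.verts_eq]⟩
  have hbound := h.isBound hM hpos hG hanc (fun i => Finset.inter_subset_left) v
  rwa [G.verts_eq, ← Finset.compl_eq_univ_sdiff, ← hM.1.doProb_eq_query] at hbound

end Transport

end Soundness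

theorem mainTheorem7 {V : Type uV} [Fintype V] [DecidableEq V]
    {Ω : V → Type uΩ} [∀ v, Fintype (Ω v)] {ι : Type uι}
    (G : CausalDiagram V) (Δ : ι → Finset V) (𝒵 : ι → Finset (Finset V))
    (X Y : Finset V) (hXY : Disjoint X Y) :
    (∀ e : Expression Ω 𝒵, PaTR BoundType.lower Y X G.toMixedGraph Δ e →
      ∀ 𝓜 : ModelCollection.{uV, uΩ, uι, uκ, uU} Ω ι, 𝓜.Induces G Δ → 𝓜.Positive 𝒵 →
        ∀ v : Assign Ω, e (𝓜.data 𝒵) v ≤ 𝓜.target.doProb X Y v) ∧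
    (∀ e : Expression Ω 𝒵, PaTR BoundType.upper Y X G.toMixedGraph Δ e →
      ∀ 𝓜 : ModelCollection.{uV, uΩ, uι, uκ, uU} Ω ι, 𝓜.Induces G Δ → 𝓜.Positive 𝒵 →
        ∀ v : Assign Ω, 𝓜.target.doProb X Y v ≤ e (𝓜.data 𝒵) v) ∧
    (∀ l u : Expression Ω 𝒵, PaTR BoundType.lower Y X G.toMixedGraph Δ l →
      PaTR BoundType.upper Y X G.toMixedGraph Δ u →
        ∀ v : Assign Ω, IsPartiallyTransportableBound.{uV, uΩ, uι, uκ, uU} G Δ 𝒵 X Y v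
          (fun D => l D v) (fun D => min 1 (u D v))) := by
  refine ⟨fun e he 𝓜 hM hpos v => (he.isBound_doProb hM hpos v).2,
    fun e he 𝓜 hM hpos v => he.isBound_doProb hM hpos v, ?_⟩
  intro l u hl hu v 𝓜 hM hpos
  obtain ⟨hl₀, hl₁⟩ := hl.isBound_doProb hM hpos v
  have hu₁ : 𝓜.target.doProb X Y v ≤ u (𝓜.data 𝒵) v := hu.isBound_doProb hM hpos v
  have hle_one : 𝓜.target.doProb X Y v ≤ 1 := MeasureTheory.measureReal_le_one
  refine ⟨⟨fun r hr => ⟨hl₀.le.trans hr.1, hr.2.trans (min_le_left _ _)⟩, fun h => ?_⟩,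
    hl₁, le_min hle_one hu₁⟩
  exact hl₀.not_ge (h ⟨le_rfl, zero_le_one⟩).1
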